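/- Let $\mathbb P=(P,\le)$ be a forcing notion, i.e. a set $P$ with a reflexive and transitive relation $\le$ (in particular, $\mathbb P$ may be any partial order); $p\le q$ is read "$p$ extends $q$". For an infinite cardinal $\theta$, $H(\theta)$ is the set of all sets whose transitive closure has cardinality less than $\theta$. A club of $[H(\theta)]^{\aleph_0}$ is a $\subseteq$-cofinal set of countably infinite subsets of $H(\theta)$ that is closed under unions of $\subseteq$-increasing $\omega$-sequences. For a countable elementary submodel $N$ of $(H(\theta);\in)$ let $\delta_N=N\cap\omega_1\in\omega_1$ be its height. A collection $\mathcal N$ of countable elementary submodels of $H(\theta)$ is stratified if for all $N_0,N_1\in\mathcal N$, $\delta_{N_0}<\delta_{N_1}$ implies $\operatorname{ot}(N_0\cap\omega_2)<\delta_{N_1}$. A condition $p\in P$ is $(N,\mathbb P)$-generic if for every maximal antichain $A\in N$ of $\mathbb P$, every $q\le p$ is compatible with some element of $A\cap N$. $\mathbb P$ has the $\aleph_{1.5}$-c.c. with respect to finite stratified families of models if for every infinite cardinal $\theta$ with $\mathbb P\in H(\theta)$ there is a club $E$ of $[H(\theta)]^{\aleph_0}$ such that for every finite stratified $\mathcal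 N\subseteq E$, every $N_0\in\mathcal N$ of minimal height within $\mathcal N$ and every $p\in P\cap N_0$, there is $p^*\le p$ that is $(N,\mathbb P)$-generic for all $N\in\mathcal N$. $\mathbb P$ is proper if for every infinite cardinal $\theta$ with $\mathbb P\in H(\theta)$ there is a club $D$ of $[H(\theta)]^{\aleph_0}$ such that for all $N\in D$ and $p\in P\cap N$ there is an $(N,\mathbb P)$-generic $p^*\le p$. $\mathbb P$ has the $\aleph_2$-chain condition if every antichain of $\mathbb P$ has cardinality less than $\aleph_2$. Proposition. If $\mathbb P$ has the $\aleph_{1.5}$-c.c. with respect to finite stratified families of models, then $\mathbb P$ is proper and has the $\aleph_2$-chain condition. -/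

import Mathlib

universe u

open Cardinal Ordinal

noncomputable section

/-! The universe of sets is `ZFSet.{u}`; ordinals are identified with von Neumann ordinals through
`Ordinal.toZFSet`. -/

/-- The transitive closure `trcl(x)`: all `y` with `y ∈ x₁ ∈ ⋯ ∈ xₙ ∈ x` for some `n ≥ 0`. -/
def trcl (x : ZFSet.{u}) : Set ZFSet.{u} :=
  {y | Relation.TransGen (fun a b : ZFSet.{u} => a ∈ b) y x}

/-- `H(θ)`: the sets whose transitive closure has cardinality less than `θ`. -/
def hSet (θ : Cardinal.{u}) : Set ZFSet.{u} :=
  {x | #(trcl x) < Cardinal.lift.{u + 1} θ}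

/-- `[X]^{ℵ₀}`: the countably infinite subsets of `X`. -/
def countablyInfiniteSubsets (X : Set ZFSet.{u}) : Set (Set ZFSet.{u}) :=
  {N | N ⊆ X ∧ N.Countable ∧ N.Infinite}

/-- `E` is a club of `[X]^{ℵ₀}`. -/
structure IsClubOfCountable (X : Set ZFSet.{u}) (E : Set (Set ZFSet.{u})) : Prop where
  subset : E ⊆ countablyInfiniteSubsets X
  unbounded : ∀ Y ∈ countablyInfiniteSubsets X, ∃ N ∈ E, Y ⊆ N
  closed : ∀ f : ℕ → Set ZFSet.{u}, Monotone f → (∀ n, f n ∈ E) → (⋃ n, f n) ∈ E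

/-- The relation symbols of the language of set theory: one binary symbol. -/
inductive SetTheoryRel : ℕ → Type
  | mem : SetTheoryRel 2

/-- The first-order language of set theory. -/
def setTheoryLanguage : FirstOrder.Language.{0, 0} where
  Functions := fun _ => Empty
  Relations := SetTheoryRel

/-- Every set `X` of sets is read as the structure `(X; ∈)`. -/
instance memStructure (X : Set ZFSet.{u}) : setTheoryLanguage.Structure X where
  funMap := fun f _ => Empty.elim f
  RelMap := fun r v =>
    match r, v with
    | SetTheoryRel.mem, v => (v 0 : ZFSet.{u}) ∈ (v 1 : ZFSet.{u})

/-- `(N; ∈)` is an elementary substructure of `(X; ∈)`. -/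
def IsElementarySubmodel (N X : Set ZFSet.{u}) : Prop :=
  ∃ S : setTheoryLanguage.ElementarySubstructure X, N = Subtype.val '' (S : Set X)

/-- `N ∩ β`, as a set of ordinals. -/
def ordinalTrace (N : Set ZFSet.{u}) (β : Ordinal.{u}) : Set Ordinal.{u} :=
  {α | α < β ∧ α.toZFSet ∈ N}

/-- The order type of a set of ordinals. -/
def orderTypeOf (S : Set Ordinal.{u}) : Ordinal.{u + 1} :=
  Ordinal.type (fun a b : S => a < b)

/-- The height `δ_N` of `N`, as the least ordinal not in `N`; whenever `N ∩ ω₁` is an ordinal below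
`ω₁`, it is this ordinal, see `modelHeight_eq`. -/
def modelHeight (N : Set ZFSet.{u}) : Ordinal.{u} :=
  sInf {α | α.toZFSet ∉ N}

theorem modelHeight_eq (N : Set ZFSet.{u}) (δ : Ordinal.{u}) (hδ : δ < ω_ 1)
    (h : ordinalTrace N (ω_ 1) = Set.Iio δ) : modelHeight N = δ := by
  have hmem : ∀ α, α < ω_ 1 → (α.toZFSet ∈ N ↔ α < δ) := fun α hα => by
    have := Set.ext_iff.1 h α
    simpa [ordinalTrace, hα] using this
  have hδN : δ ∈ {α : Ordinal.{u} | α.toZFSet ∉ N} := fun hN =>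
    lt_irrefl _ ((hmem δ hδ).1 hN)
  refine le_antisymm (csInf_le' hδN) (le_csInf ⟨δ, hδN⟩ fun α hα => ?_)
  by_contra hlt
  exact hα ((hmem α ((not_le.1 hlt).trans hδ)).2 (not_le.1 hlt))

/-- A stratified collection of countable elementary submodels of `H(θ)`. -/
structure IsStratified (θ : Cardinal.{u}) (𝒩 : Set (Set ZFSet.{u})) : Prop where
  countable : ∀ N ∈ 𝒩, N.Countable
  elementary : ∀ N ∈ 𝒩, IsElementarySubmodel N (hSet θ)
  stratified : ∀ N₀ ∈ 𝒩, ∀ N₁ ∈ 𝒩, modelHeight N₀ < modelHeight N₁ →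
    orderTypeOf (ordinalTrace N₀ (ω_ 2)) < Ordinal.lift.{u + 1} (modelHeight N₁)

/-- A forcing notion: a set with a reflexive and transitive relation, where `p ≤ q` is read
`p` extends `q`. Partial orders are the special case of an antisymmetric relation. -/
structure ForcingNotion where
  carrier : ZFSet.{u}
  order : ZFSet.{u}
  order_subset : order ⊆ ZFSet.prod carrier carrier
  refl : ∀ p ∈ carrier, ZFSet.pair p p ∈ order
  trans : ∀ p q r, ZFSet.pair p q ∈ order → ZFSet.pair q r ∈ order → ZFSet.pair p r ∈ order

namespace ForcingNotion

/-- The forcing notion as the set `(P, ≤)`. -/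
def toZFSet (P : ForcingNotion.{u}) : ZFSet.{u} := ZFSet.pair P.carrier P.order

/-- `p` extends `q`. -/
def Extends (P : ForcingNotion.{u}) (p q : ZFSet.{u}) : Prop := ZFSet.pair p q ∈ P.order

/-- `p` and `q` have a common extension. -/
def Compatible (P : ForcingNotion.{u}) (p q : ZFSet.{u}) : Prop :=
  ∃ r, P.Extends r p ∧ P.Extends r q

/-- `A` is a set of pairwise incompatible conditions. -/
def IsAntichain (P : ForcingNotion.{u}) (A : ZFSet.{u}) : Prop :=
  A ⊆ P.carrier ∧ ∀ a ∈ A, ∀ b ∈ A, a ≠ b → ¬ P.Compatible a b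

/-- `A` is an antichain that is maximal under inclusion. -/
def IsMaximalAntichain (P : ForcingNotion.{u}) (A : ZFSet.{u}) : Prop :=
  P.IsAntichain A ∧ ∀ B, P.IsAntichain B → A ⊆ B → B = A

/-- `p` is `(N, P)`-generic: for every maximal antichain `A ∈ N`, `A ∩ N` is predense below `p`. -/
def IsGeneric (P : ForcingNotion.{u}) (N : Set ZFSet.{u}) (p : ZFSet.{u}) : Prop :=
  ∀ A ∈ N, P.IsMaximalAntichain A →
    ∀ q, P.Extends q p → ∃ a, a ∈ A ∧ a ∈ N ∧ P.Compatible a q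

/-- The `ℵ_{1.5}`-c.c. with respect to finite stratified families of models. -/
def HasStratifiedAleph15CC (P : ForcingNotion.{u}) : Prop :=
  ∀ θ : Cardinal.{u}, ℵ₀ ≤ θ → P.toZFSet ∈ hSet θ →
    ∃ E : Set (Set ZFSet.{u}), IsClubOfCountable (hSet θ) E ∧
      ∀ 𝒩 : Set (Set ZFSet.{u}), 𝒩.Finite → 𝒩 ⊆ E → IsStratified θ 𝒩 →
        ∀ N₀ ∈ 𝒩, (∀ N ∈ 𝒩, modelHeight N₀ ≤ modelHeight N) →
          ∀ p ∈ P.carrier, p ∈ N₀ →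
            ∃ p', P.Extends p' p ∧ ∀ N ∈ 𝒩, P.IsGeneric N p'

/-- Properness. -/
def IsProper (P : ForcingNotion.{u}) : Prop :=
  ∀ θ : Cardinal.{u}, ℵ₀ ≤ θ → P.toZFSet ∈ hSet θ →
    ∃ D : Set (Set ZFSet.{u}), IsClubOfCountable (hSet θ) D ∧
      ∀ N ∈ D, ∀ p ∈ P.carrier, p ∈ N → ∃ p', P.Extends p' p ∧ P.IsGeneric N p'

/-- The `ℵ₂`-chain condition: every antichain has cardinality less than `ℵ₂`. -/
def HasAlephTwoCC (P : ForcingNotion.{u}) : Prop :=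
  ∀ A : ZFSet.{u}, P.IsAntichain A → A.card < ℵ_ 2

end ForcingNotion

end

/-! Two models of equal height are vacuously stratified, and each has minimal height, so a condition
in either extends to one generic for both (`exists_club_generic_pair`). Taking the two models equal
gives properness. For the chain condition, let `A` be a maximal antichain of size at least `ℵ₂` and
choose for each `a ∈ A` a model containing `a` and `A`. There are only `ℵ₁` heights, so uncountably
many of these models share one. Fix `b` among their indices: its model is countable, hence omits
some such `a`. An extension of `a` generic for the model of `b` is compatible with some `c ∈ A` in
that model, so `c ≠ a` is compatible with `a`, a contradiction. -/

/-! ### Clubs of countable sets -/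

/-- The clubs of `[X]^{ℵ₀}` are closed under binary intersections. -/
theorem IsClubOfCountable.inter {X : Set ZFSet.{u}} {E F : Set (Set ZFSet.{u})}
    (hE : IsClubOfCountable X E) (hF : IsClubOfCountable X F) : IsClubOfCountable X (E ∩ F) where
  subset := fun _ hN => hE.subset hN.1
  unbounded := by
    intro Y hY
    choose! e he hYe using hE.unbounded
    choose! f hf hYf using hF.unbounded
    -- Interleave: `g n ∈ E` and `f (g n) ∈ F` alternate in one increasing chain, so both
    -- subsequences have the same union.
    let g : ℕ → Set ZFSet.{u} := fun n => (fun N => e (f N))^[n] (e Y)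
    have hsucc : ∀ n, g (n + 1) = e (f (g n)) := fun n =>
      Function.iterate_succ_apply' (fun N => e (f N)) n (e Y)
    have hgE : ∀ n, g n ∈ E := by
      intro n
      induction n with
      | zero => exact he Y hY
      | succ n ih => rw [hsucc]; exact he _ (hF.subset (hf _ (hE.subset ih)))
    have hfF : ∀ n, f (g n) ∈ F := fun n => hf _ (hE.subset (hgE n))
    have hgf : ∀ n, g n ⊆ f (g n) := fun n => hYf _ (hE.subset (hgE n))
    have hfg : ∀ n, f (g n) ⊆ g (n + 1) := fun n => by
      rw [hsucc]; exact hYe _ (hF.subset (hfF n))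
    have hunion : ⋃ n, g n = ⋃ n, f (g n) := by
      refine Set.Subset.antisymm (Set.iUnion_mono hgf) (Set.iUnion_subset fun n => ?_)
      exact (hfg n).trans (Set.subset_iUnion g (n + 1))
    refine ⟨⋃ n, g n, ⟨?_, ?_⟩, (hYe Y hY).trans (Set.subset_iUnion g 0)⟩
    · exact hE.closed g (monotone_nat_of_le_succ fun n => (hgf n).trans (hfg n)) hgE
    · rw [hunion]
      exact hF.closed _ (monotone_nat_of_le_succ fun n => (hfg n).trans (hgf (n + 1))) hfF
  closed := fun f hf h =>
    ⟨hE.closed f hf fun n => (h n).1, hF.closed f hf fun n => (h n).2⟩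

/-- If `X` is infinite, then a club of `[X]^{ℵ₀}` is cofinal in all countable subsets of `X`. -/
theorem IsClubOfCountable.exists_superset {X : Set ZFSet.{u}} {E : Set (Set ZFSet.{u})}
    (hE : IsClubOfCountable X E) (hX : X.Infinite) {Y : Set ZFSet.{u}} (hYX : Y ⊆ X)
    (hY : Y.Countable) : ∃ N ∈ E, Y ⊆ N := by
  -- Cofinality only concerns infinite sets, so a possibly finite `Y` is padded.
  let s : Set ZFSet.{u} := Set.range fun n => (hX.natEmbedding X n : ZFSet.{u})
  have hs : s.Infinite := Set.infinite_range_of_injective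
    (Subtype.val_injective.comp (hX.natEmbedding X).injective)
  obtain ⟨N, hN, hYN⟩ := hE.unbounded (Y ∪ s)
    ⟨Set.union_subset hYX (Set.range_subset_iff.2 fun n => (hX.natEmbedding X n).2),
      hY.union (Set.countable_range _), hs.mono Set.subset_union_right⟩
  exact ⟨N, hN, Set.subset_union_left.trans hYN⟩

/-! ### The club of countable elementary submodels -/

open FirstOrder FirstOrder.Language in
theorem countable_closure_skolem {X : Set ZFSet.{u}} [Nonempty X] {s : Set X}
    (hs : s.Countable) :
    (Substructure.closure (setTheoryLanguage.sum setTheoryLanguage.skolem₁) s : Set X).Countable := by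
  have hrel : Countable (Σ n, SetTheoryRel n) :=
    Function.Injective.countable (f := fun _ => ()) (by rintro ⟨_, ⟨⟩⟩ ⟨_, ⟨⟩⟩ _; rfl)
  have hL : setTheoryLanguage.card ≤ ℵ₀ := by
    have : Countable setTheoryLanguage.Symbols := by
      have : IsEmpty (Σ n, setTheoryLanguage.Functions n) := ⟨fun x => x.2.elim⟩
      have : Countable (Σ n, setTheoryLanguage.Relations n) := hrel
      exact inferInstanceAs (Countable (_ ⊕ _))
    exact Cardinal.mk_le_aleph0
  have hfun : #(Σ n, (setTheoryLanguage.sum setTheoryLanguage.skolem₁).Functions n) ≤ ℵ₀ :=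
    card_functions_sum_skolem₁_le.trans (max_le le_rfl hL)
  have hcard := Substructure.lift_card_closure_le
    (L := setTheoryLanguage.sum setTheoryLanguage.skolem₁) (s := s)
  have hs' : #s ≤ ℵ₀ := Cardinal.le_aleph0_iff_set_countable.2 hs
  rw [← Cardinal.le_aleph0_iff_set_countable, ← Cardinal.lift_le_aleph0]
  refine hcard.trans (max_le le_rfl ?_)
  exact Cardinal.add_le_aleph0.2 ⟨Cardinal.lift_le_aleph0.2 hs', Cardinal.lift_le_aleph0.2 hfun⟩

open FirstOrder FirstOrder.Language in
/-- The countable elementary submodels of an infinite `X` contain a club of `[X]^{ℵ₀}`. -/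
theorem exists_club_elementarySubmodel {X : Set ZFSet.{u}} (hX : X.Infinite) :
    ∃ F, IsClubOfCountable X F ∧ ∀ N ∈ F, IsElementarySubmodel N X := by
  have : Nonempty X := hX.nonempty.to_subtype
  let L := setTheoryLanguage.sum setTheoryLanguage.skolem₁
  refine ⟨{N | N ∈ countablyInfiniteSubsets X ∧
    ∃ S : L.Substructure X, N = Subtype.val '' (S : Set X)}, ⟨fun N hN => hN.1, ?_, ?_⟩, ?_⟩
  · rintro Y ⟨hYX, hYc, hYi⟩
    let S := Substructure.closure L (Subtype.val ⁻¹' Y : Set X)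
    have hYS : Y ⊆ Subtype.val '' (S : Set X) := fun y hy =>
      ⟨⟨y, hYX hy⟩, Substructure.subset_closure hy, rfl⟩
    have hS : (S : Set X).Countable :=
      countable_closure_skolem (hYc.preimage Subtype.val_injective)
    exact ⟨_, ⟨⟨by rintro _ ⟨x, _, rfl⟩; exact x.2, hS.image _, hYi.mono hYS⟩, S, rfl⟩, hYS⟩
  · intro f hf h
    choose hc S hS using h
    have hmono : Monotone fun n => (S n : Set X) := by
      intro m n hmn
      refine (Set.image_subset_image_iff Subtype.val_injective).1 ?_
      rw [← hS, ← hS]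
      exact hf hmn
    refine ⟨⟨Set.iUnion_subset fun n => (hc n).1, Set.countable_iUnion fun n => (hc n).2.1,
      (hc 0).2.2.mono (Set.subset_iUnion f 0)⟩,
      ⟨⋃ n, (S n : Set X), fun g x hx => ?_⟩, ?_⟩
    · choose k hk using fun i => Set.mem_iUnion.1 (hx i)
      -- The finitely many arguments of `g` all lie in one stage of the chain.
      refine Set.mem_iUnion.2 ⟨Finset.univ.sup k, (S _).fun_mem g x fun i => ?_⟩
      exact hmono (Finset.le_sup (Finset.mem_univ i)) (hk i)
    · simp only [hS]
      exact Set.image_iUnion.symm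
  · rintro N ⟨_, S, rfl⟩
    exact ⟨S.elementarySkolem₁Reduct, rfl⟩

/-! ### The sets `H(θ)` -/

theorem trcl_subset_of_isTransitive {x y : ZFSet.{u}} (hy : y.IsTransitive) (hx : x ∈ y) :
    trcl x ⊆ (y : Set ZFSet.{u}) := by
  intro z hz
  induction hz using Relation.TransGen.head_induction_on with
  | single h => exact hy.mem_trans h hx
  | head h _ ih => exact hy.mem_trans h ih

theorem mem_hSet_of_isTransitive {θ : Cardinal.{u}} {x y : ZFSet.{u}} (hy : y.IsTransitive)
    (hx : x ∈ y) (hθ : y.card < θ) : x ∈ hSet θ := by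
  refine (Cardinal.mk_le_mk_of_subset (trcl_subset_of_isTransitive hy hx)).trans_lt ?_
  exact ZFSet.cardinalMk_coe_sort.trans_lt (Cardinal.lift_lt.2 hθ)

/-- Some `V_α` contains both sets; it is transitive, so any infinite `θ > |V_α|` works. -/
theorem exists_mem_hSet (x y : ZFSet.{u}) :
    ∃ θ : Cardinal.{u}, ℵ₀ ≤ θ ∧ x ∈ hSet θ ∧ y ∈ hSet θ := by
  let v := ZFSet.vonNeumann (Order.succ (max x.rank y.rank))
  have hv : v.card < Order.succ (max ℵ₀ v.card) := Order.lt_succ_of_le (le_max_right _ _)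
  refine ⟨_, (le_max_left _ _).trans (Order.le_succ _),
    mem_hSet_of_isTransitive (ZFSet.isTransitive_vonNeumann _) ?_ hv,
    mem_hSet_of_isTransitive (ZFSet.isTransitive_vonNeumann _) ?_ hv⟩
  · exact ZFSet.mem_vonNeumann.2 (Order.lt_succ_of_le (le_max_left _ _))
  · exact ZFSet.mem_vonNeumann.2 (Order.lt_succ_of_le (le_max_right _ _))

theorem natCast_toZFSet_mem_hSet {θ : Cardinal.{u}} (hθ : ℵ₀ ≤ θ) (n : ℕ) :
    (n : Ordinal.{u}).toZFSet ∈ hSet θ := by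
  refine mem_hSet_of_isTransitive (y := ((n + 1 : ℕ) : Ordinal.{u}).toZFSet)
    (ZFSet.isOrdinal_toZFSet _).isTransitive ?_ ?_
  · exact Ordinal.toZFSet_mem_toZFSet_iff.2 (by exact_mod_cast Nat.lt_succ_self n)
  · rw [Ordinal.card_toZFSet, Ordinal.card_nat]
    exact (Cardinal.natCast_lt_aleph0).trans_le hθ

theorem infinite_hSet {θ : Cardinal.{u}} (hθ : ℵ₀ ≤ θ) : (hSet θ).Infinite :=
  Set.infinite_of_injective_forall_mem
    (f := fun n : ℕ => (n : Ordinal.{u}).toZFSet)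
    (Ordinal.toZFSet_injective.comp Nat.cast_injective) (natCast_toZFSet_mem_hSet hθ)

theorem modelHeight_lt_omega_one {N : Set ZFSet.{u}} (hN : N.Countable) :
    modelHeight N < ω_ 1 := by
  by_contra! h
  have hsub : Ordinal.toZFSet '' Set.Iio (ω_ 1) ⊆ N := by
    rintro _ ⟨α, hα, rfl⟩
    by_contra hαN
    exact (csInf_le' (s := {α : Ordinal.{u} | α.toZFSet ∉ N}) hαN).not_gt (hα.trans_le h)
  have hc : (Set.Iio (ω_ 1 : Ordinal.{u})).Countable :=
    Set.countable_of_injective_of_countable_image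
      Ordinal.toZFSet_injective.injOn (hN.mono hsub)
  rw [← Cardinal.le_aleph0_iff_set_countable, Cardinal.mk_Iio_ordinal] at hc
  simp only [Ordinal.card_omega, Cardinal.lift_aleph] at hc
  exact hc.not_gt (by simp)

namespace ForcingNotion

theorem exists_maximalAntichain_superset (P : ForcingNotion.{u}) {A : ZFSet.{u}}
    (hA : P.IsAntichain A) : ∃ B, P.IsMaximalAntichain B ∧ A ⊆ B := by
  let 𝒜 : Set (Set ZFSet.{u}) :=
    {s | s ⊆ (P.carrier : Set ZFSet.{u}) ∧ s.Pairwise fun a b => ¬ P.Compatible a b}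
  have hmem : ∀ B : ZFSet.{u}, P.IsAntichain B ↔ (B : Set ZFSet.{u}) ∈ 𝒜 := fun B => Iff.rfl
  obtain ⟨M, hAM, hM⟩ := zorn_subset_nonempty 𝒜 (fun c hc hchain _ =>
    ⟨⋃₀ c, ⟨Set.sUnion_subset fun s hs => (hc hs).1,
      (Set.pairwise_sUnion hchain.directedOn).2 fun s hs => (hc hs).2⟩,
      fun s hs => Set.subset_sUnion_of_mem hs⟩) A ((hmem A).1 hA)
  -- Zorn yields a class-sized `Set`; being inside the carrier, it is a genuine set by separation.
  have hB : (P.carrier.sep (· ∈ M) : Set ZFSet.{u}) = M := by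
    ext x
    simpa using fun hx => hM.prop.1 hx
  refine ⟨P.carrier.sep (· ∈ M), ⟨(hmem _).2 (by rw [hB]; exact hM.prop), fun C hC hBC => ?_⟩, ?_⟩
  · apply SetLike.coe_injective
    rw [hB]
    exact (hM.eq_of_subset hC (by rw [← hB]; exact hBC)).symm
  · intro x hx
    exact ZFSet.mem_sep.2 ⟨hA.1 hx, hAM hx⟩

/-- The `ℵ_{1.5}`-c.c. for pairs of models of equal height: such pairs are stratified. -/
theorem HasStratifiedAleph15CC.exists_club_generic_pair {P : ForcingNotion.{u}}
    (hP : P.HasStratifiedAleph15CC) {θ : Cardinal.{u}} (hθ : ℵ₀ ≤ θ) (hPθ : P.toZFSet ∈ hSet θ) :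
    ∃ D : Set (Set ZFSet.{u}), IsClubOfCountable (hSet θ) D ∧
      ∀ N₀ ∈ D, ∀ N₁ ∈ D, modelHeight N₀ = modelHeight N₁ → ∀ p ∈ P.carrier, p ∈ N₀ →
        ∃ p', P.Extends p' p ∧ P.IsGeneric N₀ p' ∧ P.IsGeneric N₁ p' := by
  obtain ⟨E, hE, hgen⟩ := hP θ hθ hPθ
  obtain ⟨F, hF, helem⟩ := exists_club_elementarySubmodel (infinite_hSet hθ)
  refine ⟨E ∩ F, hE.inter hF, fun N₀ h₀ N₁ h₁ hδ p hp hpN => ?_⟩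
  have hheight : ∀ N ∈ ({N₀, N₁} : Set (Set ZFSet.{u})), modelHeight N = modelHeight N₀ := by
    rintro N (rfl | rfl)
    exacts [rfl, hδ.symm]
  have hsub : ({N₀, N₁} : Set (Set ZFSet.{u})) ⊆ E ∩ F := by
    rintro N (rfl | rfl)
    exacts [h₀, h₁]
  obtain ⟨p', hp', hN⟩ := hgen {N₀, N₁} (Set.toFinite _) (hsub.trans Set.inter_subset_left)
    ⟨fun N hN => (hE.subset (hsub hN).1).2.1, fun N hN => helem N (hsub hN).2,
      fun M hM N hN hlt => absurd hlt (by rw [hheight M hM, hheight N hN]; exact lt_irrefl _)⟩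
    N₀ (Set.mem_insert _ _) (fun N hN => (hheight N hN).ge) p hp hpN
  exact ⟨p', hp', hN N₀ (by simp), hN N₁ (by simp)⟩

theorem HasStratifiedAleph15CC.isProper {P : ForcingNotion.{u}}
    (hP : P.HasStratifiedAleph15CC) : P.IsProper := by
  intro θ hθ hPθ
  obtain ⟨D, hD, hgen⟩ := hP.exists_club_generic_pair hθ hPθ
  refine ⟨D, hD, fun N hN p hp hpN => ?_⟩
  obtain ⟨p', hp', h, -⟩ := hgen N hN N hN rfl p hp hpN
  exact ⟨p', hp', h⟩

theorem HasStratifiedAleph15CC.hasAlephTwoCC {P : ForcingNotion.{u}}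
    (hP : P.HasStratifiedAleph15CC) : P.HasAlephTwoCC := by
  intro A₀ hA₀
  -- Genericity speaks only of maximal antichains.
  obtain ⟨A, hA, hA₀A⟩ := P.exists_maximalAntichain_superset hA₀
  refine (ZFSet.card_mono hA₀A).trans_lt ?_
  by_contra! hcard
  obtain ⟨θ, hθ, hPθ, hAθ⟩ := exists_mem_hSet P.toZFSet A
  obtain ⟨D, hD, hgen⟩ := hP.exists_club_generic_pair hθ hPθ
  have hmodel : ∀ a : A, ∃ N ∈ D, ({(a : ZFSet.{u}), A} : Set ZFSet.{u}) ⊆ N := by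
    refine fun a => hD.exists_superset (infinite_hSet hθ) ?_ (Set.toFinite _).countable
    rintro x (rfl | rfl)
    · refine (Cardinal.mk_le_mk_of_subset fun z hz => ?_).trans_lt hAθ
      exact Relation.TransGen.tail hz a.2
    · exact hAθ
  choose N hND hN using hmodel
  have hcount : ∀ a, (N a).Countable := fun a => (hD.subset (hND a)).2.1
  let height : A → Set.Iio (ω_ 1 : Ordinal.{u}) :=
    fun a => ⟨modelHeight (N a), modelHeight_lt_omega_one (hcount a)⟩
  have hA2 : ℵ_ 2 ≤ #A := by
    rw [ZFSet.cardinalMk_coe_sort]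
    simpa using Cardinal.lift_le.{u + 1}.2 hcard
  have : Uncountable A := by
    rw [← Cardinal.aleph0_lt_mk_iff]
    refine lt_of_lt_of_le ?_ hA2
    simp
  have hlt : #(Set.Iio (ω_ 1 : Ordinal.{u})) < #A := by
    refine lt_of_lt_of_le ?_ hA2
    rw [Cardinal.mk_Iio_ordinal]
    simp
  obtain ⟨δ, hδ⟩ := Cardinal.exists_uncountable_fiber height hlt
  obtain ⟨b, hb⟩ : (height ⁻¹' {δ}).Nonempty := Set.nonempty_coe_sort.1 inferInstance
  obtain ⟨a, ha, haN⟩ : ∃ a ∈ height ⁻¹' {δ}, (a : ZFSet.{u}) ∉ N b := by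
    by_contra! h
    exact not_countable_iff.2 hδ
      (((hcount b).preimage Subtype.val_injective).mono h).to_subtype
  have hab : modelHeight (N a) = modelHeight (N b) :=
    congrArg Subtype.val (Eq.trans ha (Eq.symm hb))
  obtain ⟨p, hpa, -, hp⟩ := hgen (N a) (hND a) (N b) (hND b) hab a (hA.1.1 a.2)
    (hN a (Set.mem_insert _ _))
  have hpP : p ∈ P.carrier := (ZFSet.pair_mem_prod.1 (P.order_subset hpa)).1
  -- Genericity for `N b` is applied with `q = p`.
  obtain ⟨c, hcA, hcN, r, hrc, hrp⟩ := hp A (hN b (by simp)) hA p (P.refl p hpP)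
  have hca : c ≠ a := fun h => haN (h ▸ hcN)
  exact hA.1.2 c hcA a a.2 hca ⟨r, hrc, P.trans _ _ _ hrp hpa⟩

end ForcingNotion

theorem proposition1 (P : ForcingNotion.{u}) (hP : P.HasStratifiedAleph15CC) :
    P.IsProper ∧ P.HasAlephTwoCC :=
  ⟨hP.isProper, hP.hasAlephTwoCC⟩
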